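/- Let $L\ge 1$ and $\mathcal U=[0,1]^{L-1}\times\{1\}\subset\mathbb R^L$. Fix a constant sampling interval $\Delta>0$. Definition (B$_2$S$_6$ unit with sampling interval $\Delta$). Let $h,p,n\ge1$ and $d=hp$, and write vectors of $\mathbb R^d$ as stacks $\mathbf v=({}^1\mathbf v^\top,\dots,{}^h\mathbf v^\top)^\top$ of $h$ blocks ${}^j\mathbf v\in\mathbb R^p$. The parameters are an invertible diagonal matrix $\mathbf A\in\mathbb R^{n\times n}$ and, for $1\le j\le h$ and $1\le i\le p$, ${}^j\mathbf B_{\rm weight}\in\mathbb R^{n\times p}$, ${}^j\mathbf B^{(i)}_{\rm bias}\in\mathbb R^{n}$ and ${}^j\mathbf C\in\mathbb R^{p\times n}$. For an input sequence $\mathbf u_1,\dots,\mathbf u_L\in\mathbb R^d$, the unit $\Gamma$ returns the sequence $\mathbf y_1,\dots,\mathbf y_L\in\mathbb R^d$ given, with ${}^j\mathbf x^{(i)}_0=\mathbf 0\in\mathbb R^n$ and for $1\le k\le L$, by $${}^j\mathbf x^{(i)}_k=e^{\Delta\mathbf A}\,{}^j\mathbf x^{(i)}_{k-1}+\mathbf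 A^{-1}\bigl(e^{\Delta\mathbf A}-\mathbf I\bigr)\bigl({}^j\mathbf B_{\rm weight}\,{}^j\mathbf u_k+{}^j\mathbf B^{(i)}_{\rm bias}\bigr)\,{}^j\mathbf u^{(i)}_k,\qquad {}^j\mathbf y^{(i)}_k={}^j\mathbf u_k^\top\,{}^j\mathbf C\;{}^j\mathbf x^{(i)}_k .$$ Given $\mathbf M,\mathbf N,\boldsymbol\theta\in\mathbb R^d$ and $\sigma:\mathbb R\to\mathbb R$ (applied entrywise), the single-layer model is $$\tilde G(u_1,\dots,u_L)=\mathbf N^\top\sigma\bigl(\Gamma(u_1\mathbf M,\dots,u_L\mathbf M)_L+\boldsymbol\theta\bigr).$$ Theorem. Let $\sigma:\mathbb R\to\mathbb R$ be Lipschitz continuous and not a polynomial, let $G:\mathcal U\to\mathbb R$ be continuous, and let $\epsilon>0$. Then: 1. (Block structure alone.) There exist $h,p,n\ge1$, vectors $\mathbf M,\mathbf N,\boldsymbol\theta\in\mathbb R^{hp}$ and parameters $\mathbf A$, ${}^j\mathbf B_{\rm weight}$, ${}^j\mathbf C$ such that, with ${}^j\mathbf B^{(i)}_{\rm bias}=\mathbf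 0$ for all $i,j$, $|\tilde G(\mathbf u)-G(\mathbf u)|\le\epsilon$ for all $\mathbf u\in\mathcal U$. 2. (Bias alone.) There exist $d,n\ge1$, vectors $\mathbf M,\mathbf N,\boldsymbol\theta\in\mathbb R^{d}$ and parameters $\mathbf A$, ${}^1\mathbf B_{\rm weight}$, ${}^1\mathbf B^{(i)}_{\rm bias}$, ${}^1\mathbf C$ ($1\le i\le d$) of a unit with a single block, $h=1$ and $p=d$, such that $|\tilde G(\mathbf u)-G(\mathbf u)|\le\epsilon$ for all $\mathbf u\in\mathcal U$. -/

import Mathlib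

namespace B2S6

open Matrix

/-- The `j`-th sub-vector of size `p` of a vector in `ℝ^d`, `d = h * p`: the entries with
(zero-based) indices `j * p, …, j * p + (p - 1)`. -/
def block {h p : ℕ} (v : Fin (h * p) → ℝ) (j : Fin h) : Fin p → ℝ :=
  fun i => v (finProdFinEquiv (j, i))

/-- The vector in `ℝ^d`, `d = h * p`, obtained by stacking `h` sub-vectors of size `p`. -/
def stack {h p : ℕ} (y : Fin h → Fin p → ℝ) : Fin (h * p) → ℝ :=
  fun c => y (finProdFinEquiv.symm c).1 (finProdFinEquiv.symm c).2

/-- The trainable parameters of a block-biased selective state space unit with `h` blocks of size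
`p` and state dimension `n`, apart from those that produce the sampling intervals. -/
structure Params (h p n : ℕ) where
  /-- The state matrix, shared by all blocks and channels. -/
  A : Matrix (Fin n) (Fin n) ℝ
  /-- The input weights of each block. -/
  Bweight : Fin h → Matrix (Fin n) (Fin p) ℝ
  /-- The input-independent bias of each channel `i` of each block `j`. -/
  Bbias : Fin h → Fin p → (Fin n → ℝ)
  /-- The output weights of each block. -/
  C : Fin h → Matrix (Fin p) (Fin n) ℝ

namespace Params

variable {h p n : ℕ}

/-- Zero-order hold state matrix `exp (δ A)` for the sampling interval `δ`. -/
noncomputable def Abar (P : Params h p n) (δ : ℝ) : Matrix (Fin n) (Fin n) ℝ :=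
  NormedSpace.exp (δ • P.A)

/-- Zero-order hold input vector `A⁻¹ (exp (δ A) - I) (Bweight_j v + Bbias_j^(i))` of channel `i` of
block `j`, where `δ` is the sampling interval and `v` is the current input of block `j`. -/
noncomputable def Bbar (P : Params h p n) (δ : ℝ) (j : Fin h) (i : Fin p) (v : Fin p → ℝ) :
    Fin n → ℝ :=
  (P.A⁻¹ * (P.Abar δ - 1)) *ᵥ (P.Bweight j *ᵥ v + P.Bbias j i)

/-- The output row vector `vᵀ C_j` of block `j`, where `v` is the current input of block `j`. -/
def Cbar (P : Params h p n) (j : Fin h) (v : Fin p → ℝ) : Fin n → ℝ :=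
  v ᵥ* P.C j

/-- The hidden state of channel `i` of block `j` after `k` steps, started from `0`. The array `Δ`
contains the sampling intervals (time step, block, channel). The `(k+1)`-st input vector is `u k`,
as indices in `Fin L` start at `0`. -/
noncomputable def state (P : Params h p n) {L : ℕ} (Δ : Fin L → Fin h → Fin p → ℝ)
    (u : Fin L → Fin (h * p) → ℝ) (j : Fin h) (i : Fin p) : (k : ℕ) → k ≤ L → (Fin n → ℝ)
  | 0, _ => 0
  | k + 1, hk =>
      P.Abar (Δ ⟨k, hk⟩ j i) *ᵥ P.state Δ u j i k (Nat.le_of_succ_le hk) +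
        block (u ⟨k, hk⟩) j i • P.Bbar (Δ ⟨k, hk⟩ j i) j i (block (u ⟨k, hk⟩) j)

/-- The unit as a map from sequences of length `L` in `ℝ^d` to such sequences, `d = h * p`. -/
noncomputable def unit (P : Params h p n) {L : ℕ} (Δ : Fin L → Fin h → Fin p → ℝ)
    (u : Fin L → Fin (h * p) → ℝ) : Fin L → Fin (h * p) → ℝ :=
  fun k => stack fun j i => P.Cbar j (block (u k) j) ⬝ᵥ P.state Δ u j i (k + 1) k.isLt

end Params

/-- The last position of a nonempty sequence. -/
def lastPos {L : ℕ} (hL : 1 ≤ L) : Fin L := ⟨L - 1, Nat.sub_lt hL Nat.one_pos⟩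

/-- The single-layer model `u ↦ N σ(Γ(M u₁, …, M u_L)_L + θ)` with encoder `M`, decoder `N`,
bias `θ`, activation `σ` (applied entrywise) and sequence-to-sequence unit `Γ`. -/
def singleLayer {L d : ℕ} (hL : 1 ≤ L) (σ : ℝ → ℝ)
    (Γ : (Fin L → Fin d → ℝ) → (Fin L → Fin d → ℝ)) (M N θ : Fin d → ℝ) (u : Fin L → ℝ) : ℝ :=
  ∑ c, N c * σ (Γ (fun k => u k • M) (lastPos hL) c + θ c)

/-- The set `[0,1]^(L-1) × {1}`. -/
def inputs {L : ℕ} (hL : 1 ≤ L) : Set (Fin L → ℝ) :=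
  {u | (∀ k, u k ∈ Set.Icc (0 : ℝ) 1) ∧ u (lastPos hL) = 1}

end B2S6

/-!
If `f` is continuous, its window average `F t = ∫ s in 0..h, f (t + s)` is continuously
differentiable with derivative `Δ_h f`. Hence, if a closed space `V` of continuous functions
contains `φ * f (w g + θ)` for all `w` and `θ`, it contains the averages `φ * F (w g + θ)` and their
derivatives `φ * g * (Δ_h f) (w g + θ)` in `w`. Iterating `k` times from `φ = 1`, `f = σ` puts
`g ^ k` into `V`, because a continuous function whose `(k + 1)`-fold differences
`Δ_{h₀} ⋯ Δ_{h_k} f` all vanish is a polynomial. So `V` contains `exp g` for all preactivations `g`;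
these exponentials span an algebra, and by the Stone–Weierstrass theorem the ridge sums of `σ` are
dense as soon as the preactivations separate points.

With the all-ones encoder, and since the last input is `1`, each channel of the unit is linear in
the features `u k ^ 2` if only `Bweight` acts, and in the features `u k` if only `Bbias` acts. Both
families separate points of `[0,1]^(L-1) × {1}`. If `A` is diagonal with distinct nonzero entries,
a Vandermonde system shows that the coefficients of these linear forms can be prescribed. Blocks, in
the first case, and channels, in the second, then play the role of the neurons of a ridge sum.
-/

section Polynomial

open Polynomial

theorem exists_derivative_eq_of_degree_lt {F : Type*} [Field F] [CharZero F] {k : ℕ} {p : F[X]}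
    (hp : p.degree < k) : ∃ q : F[X], q.degree < (k + 1 : ℕ) ∧ derivative q = p := by
  refine ⟨∑ i ∈ p.support, C (p.coeff i / (i + 1)) * X ^ (i + 1), ?_, ?_⟩
  · rw [← mem_degreeLT]
    refine Submodule.sum_mem _ fun i hi => mem_degreeLT.2 ?_
    have hik : i < k := Nat.cast_lt.1 ((le_degree_of_mem_supp i hi).trans_lt hp)
    exact (degree_C_mul_X_pow_le _ _).trans_lt (Nat.cast_lt.2 (Nat.succ_lt_succ hik))
  · conv_rhs => rw [p.as_sum_support_C_mul_X_pow]
    rw [derivative_sum]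
    refine Finset.sum_congr rfl fun i _ => ?_
    rw [derivative_C_mul_X_pow, Nat.add_sub_cancel, Nat.cast_succ,
      div_mul_cancel₀ _ (Nat.cast_add_one_ne_zero i)]

theorem exists_eval_eq_of_hasDerivAt {f : ℝ → ℝ} {k : ℕ} {p : ℝ[X]} (hp : p.degree < k)
    (hf : ∀ x, HasDerivAt f (p.eval x) x) :
    ∃ q : ℝ[X], q.degree < (k + 1 : ℕ) ∧ ∀ x, f x = q.eval x := by
  obtain ⟨q, hq, rfl⟩ := exists_derivative_eq_of_degree_lt hp
  have hderiv (x : ℝ) : HasDerivAt (fun x => f x - q.eval x) 0 x := by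
    simpa only [sub_self] using (hf x).fun_sub (q.hasDerivAt x)
  have hconst (x : ℝ) : f x - q.eval x = f 0 - q.eval 0 :=
    is_const_of_deriv_eq_zero (fun x => (hderiv x).differentiableAt) (fun x => (hderiv x).deriv) x 0
  refine ⟨q + C (f 0 - q.eval 0), ?_, fun x => ?_⟩
  · have hC : (C (f 0 - q.eval 0)).degree < (k + 1 : ℕ) :=
      degree_C_le.trans_lt (Nat.cast_pos.2 k.succ_pos)
    exact (degree_add_le _ _).trans_lt (max_lt hq hC)
  · rw [eval_add, eval_C, ← hconst x, add_sub_cancel]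

theorem exists_eval_eq_intervalIntegral {k : ℕ} {p : ℝ → ℝ[X]} (hp : ∀ s, (p s).degree < k)
    {a b : ℝ} (hint : ∀ x, IntervalIntegrable (fun s => (p s).eval x) MeasureTheory.volume a b) :
    ∃ q : ℝ[X], q.degree < k ∧ ∀ x, ∫ s in a..b, (p s).eval x = q.eval x := by
  have hinj : Set.InjOn (Nat.cast : ℕ → ℝ) (Finset.range k) := Nat.cast_injective.injOn
  refine ⟨Lagrange.interpolate (Finset.range k) Nat.cast fun i => ∫ s in a..b, (p s).eval (i : ℝ),
    by simpa using Lagrange.degree_interpolate_lt _ hinj, fun x => ?_⟩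
  have hinterp (s : ℝ) : (p s).eval x = ∑ i ∈ Finset.range k,
      (p s).eval (i : ℝ) * (Lagrange.basis (Finset.range k) Nat.cast i).eval x := by
    conv_lhs => rw [Lagrange.eq_interpolate (f := p s) hinj (by simpa using hp s)]
    simp only [Lagrange.interpolate_apply, eval_finsetSum, eval_mul, eval_C]
  have hsum : ∫ s in a..b, (p s).eval x = ∑ i ∈ Finset.range k, ∫ s in a..b,
      (p s).eval (i : ℝ) * (Lagrange.basis (Finset.range k) Nat.cast i).eval x := by
    simp only [hinterp]
    exact intervalIntegral.integral_finsetSum fun i _ => (hint i).mul_const _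
  rw [hsum]
  simp only [Lagrange.interpolate_apply, eval_finsetSum, eval_mul, eval_C,
    intervalIntegral.integral_mul_const]

theorem hasDerivAt_integral_comp_add {E : Type*} [NormedAddCommGroup E] [NormedSpace ℝ E]
    [CompleteSpace E] {f : ℝ → E} (hf : Continuous f) (h x : ℝ) :
    HasDerivAt (fun x => ∫ s in (0 : ℝ)..h, f (x + s)) (fwdDiff h f x) x := by
  have hint (a b : ℝ) : IntervalIntegrable f MeasureTheory.volume a b := hf.intervalIntegrable a b
  have hprim (y : ℝ) : HasDerivAt (fun y => ∫ s in (0 : ℝ)..y, f s) (f y) y :=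
    hf.integral_hasStrictDerivAt 0 y |>.hasDerivAt
  have hwindow : (fun x => ∫ s in (0 : ℝ)..h, f (x + s)) =
      fun x => (∫ s in (0 : ℝ)..x + h, f s) - ∫ s in (0 : ℝ)..x, f s := by
    funext x
    rw [intervalIntegral.integral_comp_add_left, add_zero,
      intervalIntegral.integral_interval_sub_left (hint _ _) (hint _ _)]
  rw [hwindow]
  exact (hprim (x + h)).comp_add_const x h |>.fun_sub (hprim x)

theorem exists_eval_eq_of_fwdDiff {f : ℝ → ℝ} (hf : Continuous f) {k : ℕ}
    (hdiff : ∀ h, ∃ q : ℝ[X], q.degree < k ∧ ∀ x, fwdDiff h f x = q.eval x) :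
    ∃ q : ℝ[X], q.degree < (k + 1 : ℕ) ∧ ∀ x, f x = q.eval x := by
  -- `f x = ∫ s in 0..1, f (x + s) - ∫ s in 0..1, fwdDiff s f x`: the first term has derivative
  -- `fwdDiff 1 f x`, and the second is an average of polynomials of bounded degree.
  choose p hpdeg hp using hdiff
  obtain ⟨P, hPdeg, hP⟩ := exists_eval_eq_of_hasDerivAt (hpdeg 1) fun x =>
    hp 1 x ▸ hasDerivAt_integral_comp_add hf 1 x
  obtain ⟨Q, hQdeg, hQ⟩ := exists_eval_eq_intervalIntegral (a := 0) (b := 1) hpdeg fun x => by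
    simp only [← hp, fwdDiff]
    exact Continuous.intervalIntegrable (by fun_prop) _ _
  refine ⟨P - Q, (degree_sub_le _ _).trans_lt (max_lt hPdeg (hQdeg.trans ?_)), fun x => ?_⟩
  · exact_mod_cast k.lt_succ_self
  · have hmean : ∫ s in (0 : ℝ)..1, fwdDiff s f x = (∫ s in (0 : ℝ)..1, f (x + s)) - f x := by
      simp only [fwdDiff]
      rw [intervalIntegral.integral_sub (Continuous.intervalIntegrable (by fun_prop) _ _)
        intervalIntegrable_const]
      simp
    rw [eval_sub, ← hP, ← hQ]
    simp only [← hp]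
    rw [hmean, sub_sub_cancel]

end Polynomial

section ClosedSubmodule

variable {E : Type*} [NormedAddCommGroup E] [NormedSpace ℝ E] {V : Submodule ℝ E}

theorem intervalIntegral_mem_of_isClosed [CompleteSpace E] (hV : IsClosed (V : Set E)) {c : ℝ → E}
    (hc : Continuous c) (hmem : ∀ s, c s ∈ V) (a b : ℝ) : ∫ s in a..b, c s ∈ V := by
  have hcomm := V.mkQL.intervalIntegral_comp_comm (𝕜 := ℝ)
    (hc.intervalIntegrable (μ := MeasureTheory.volume) a b)
  refine (Submodule.Quotient.mk_eq_zero V).1 (hcomm.symm.trans ?_)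
  simp [(Submodule.Quotient.mk_eq_zero V).2 (hmem _)]

theorem hasDerivAt_mem_of_isClosed (hV : IsClosed (V : Set E)) {c : ℝ → E} {c' : E} {t : ℝ}
    (hc : HasDerivAt c c' t) (hmem : ∀ s, c s ∈ V) : c' ∈ V := by
  have hspan : Submodule.span ℝ (c '' Set.univ) ≤ V :=
    Submodule.span_le.2 (Set.image_subset_iff.2 fun s _ => hmem s)
  exact closure_minimal hspan hV
    (range_deriv_subset_closure_span_image c dense_univ ⟨t, hc.deriv⟩)

end ClosedSubmodule

section ContinuousMap

variable {X : Type*} [TopologicalSpace X] [CompactSpace X]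
variable {E : Type*} [NormedAddCommGroup E] [NormedSpace ℝ E] [CompleteSpace E]

theorem intervalIntegral_continuousMap_apply {c : ℝ → C(X, E)} (hc : Continuous c) (a b : ℝ)
    (x : X) : (∫ s in a..b, c s) x = ∫ s in a..b, c s x :=
  ((ContinuousMap.evalCLM ℝ x).intervalIntegral_comp_comm (hc.intervalIntegrable a b)).symm

theorem hasDerivAt_continuousMap_of_apply {c c' : ℝ → C(X, E)} (hc' : Continuous c')
    (hderiv : ∀ t x, HasDerivAt (fun s => c s x) (c' t x) t) (t : ℝ) : HasDerivAt c (c' t) t := by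
  have hprim : c = fun s => c 0 + ∫ r in (0 : ℝ)..s, c' r := by
    funext s
    ext x
    rw [ContinuousMap.add_apply, intervalIntegral_continuousMap_apply hc',
      intervalIntegral.integral_eq_sub_of_hasDerivAt (fun r _ => hderiv r x)
        (Continuous.intervalIntegrable (by fun_prop) _ _), add_sub_cancel]
  rw [hprim]
  exact (hc'.integral_hasStrictDerivAt 0 t).hasDerivAt.const_add (c 0)

theorem mul_fwdDiff_comp_affine_mem {V : Submodule ℝ C(X, ℝ)} (hV : IsClosed (V : Set C(X, ℝ)))
    {f : C(ℝ, ℝ)} {φ g : C(X, ℝ)}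
    (hmem : ∀ w θ : ℝ, φ * f.comp (w • g + .const X θ) ∈ V) (h w θ : ℝ) :
    φ * g * (f.comp (.addRight h) - f).comp (w • g + .const X θ) ∈ V := by
  obtain ⟨F, hFapply⟩ : ∃ F : C(ℝ, ℝ), ∀ t, F t = ∫ s in (0 : ℝ)..h, f (t + s) :=
    ⟨⟨_, continuous_iff_continuousAt.2 fun t =>
      (hasDerivAt_integral_comp_add f.continuous h t).continuousAt⟩, fun _ => rfl⟩
  have hFderiv (t : ℝ) : HasDerivAt F ((f.comp (.addRight h) - f) t) t :=
    (hasDerivAt_integral_comp_add f.continuous h t).congr_of_eventuallyEq (.of_forall hFapply)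
  have hF (v : ℝ) : φ * F.comp (v • g + .const X θ) ∈ V := by
    have hcont : Continuous fun s => φ * f.comp (v • g + .const X (θ + s)) := by fun_prop
    convert intervalIntegral_mem_of_isClosed hV hcont (fun s => hmem v (θ + s)) 0 h
    ext x
    rw [intervalIntegral_continuousMap_apply hcont]
    simp [hFapply, ← add_assoc]
  have hpointwise (v : ℝ) (x : X) :
      HasDerivAt (fun v => (φ * F.comp (v • g + ContinuousMap.const X θ)) x)
        ((φ * g * (f.comp (.addRight h) - f).comp (v • g + ContinuousMap.const X θ)) x) v := by
    have hinner : HasDerivAt (fun v : ℝ => v * g x + θ) (g x) v :=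
      (hasDerivAt_mul_const (g x)).add_const θ
    have hcomp := ((hFderiv (v * g x + θ)).comp v hinner).const_mul (φ x)
    exact hcomp.congr_deriv (by rw [mul_comm _ (g x), ← mul_assoc]; rfl)
  have hderiv := hasDerivAt_continuousMap_of_apply (by fun_prop) hpointwise w
  exact hasDerivAt_mem_of_isClosed hV hderiv hF

theorem mul_pow_mem_of_comp_affine_mem {V : Submodule ℝ C(X, ℝ)} (hV : IsClosed (V : Set C(X, ℝ)))
    (g : C(X, ℝ)) {k : ℕ} {f : C(ℝ, ℝ)} {φ : C(X, ℝ)}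
    (hf : ¬ ∃ q : Polynomial ℝ, q.degree < (k + 1 : ℕ) ∧ ∀ x, f x = q.eval x)
    (hmem : ∀ w θ : ℝ, φ * f.comp (w • g + .const X θ) ∈ V) : φ * g ^ k ∈ V := by
  induction k generalizing f φ with
  | zero =>
    obtain ⟨θ, hθ⟩ : ∃ θ, f θ ≠ 0 := by
      by_contra! hzero
      exact hf ⟨0, by simp, by simpa using hzero⟩
    rw [← V.smul_mem_iff hθ]
    convert hmem 0 θ using 1
    ext x
    simp [mul_comm]
  | succ k ih =>
    obtain ⟨h, hh⟩ : ∃ h, ¬ ∃ q : Polynomial ℝ, q.degree < (k + 1 : ℕ) ∧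
        ∀ x, fwdDiff h f x = q.eval x := by
      by_contra! hdiff
      exact hf (exists_eval_eq_of_fwdDiff f.continuous hdiff)
    rw [pow_succ', ← mul_assoc]
    exact ih hh (mul_fwdDiff_comp_affine_mem hV hmem h)

theorem exp_continuousMap_apply (g : C(X, ℝ)) (x : X) : NormedSpace.exp g x = Real.exp (g x) := by
  rw [Real.exp_eq_exp_ℝ]
  exact NormedSpace.map_exp (ContinuousMap.evalAlgHom ℝ ℝ x) (continuous_eval_const x) g

theorem topologicalClosure_span_exp_eq_top {W : Submodule ℝ C(X, ℝ)}
    (hW : ∀ x y : X, x ≠ y → ∃ g ∈ W, g x ≠ g y) :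
    (Submodule.span ℝ (NormedSpace.exp '' (W : Set C(X, ℝ)))).topologicalClosure = ⊤ := by
  let S : Submonoid C(X, ℝ) :=
    { carrier := NormedSpace.exp '' (W : Set C(X, ℝ))
      one_mem' := ⟨0, W.zero_mem, NormedSpace.exp_zero⟩
      mul_mem' := by
        rintro _ _ ⟨a, ha, rfl⟩ ⟨b, hb, rfl⟩
        exact ⟨a + b, W.add_mem ha hb, NormedSpace.exp_add⟩ }
  have hspan : Submodule.span ℝ (S : Set C(X, ℝ)) =
      Subalgebra.toSubmodule (Algebra.adjoin ℝ (S : Set C(X, ℝ))) := by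
    rw [Algebra.adjoin_eq_span, Submonoid.closure_eq]
  have hsep : (Algebra.adjoin ℝ (S : Set C(X, ℝ))).SeparatesPoints := by
    intro x y hxy
    obtain ⟨g, hg, hne⟩ := hW x y hxy
    refine ⟨_, ⟨NormedSpace.exp g, Algebra.subset_adjoin ⟨g, hg, rfl⟩, rfl⟩, ?_⟩
    simpa only [exp_continuousMap_apply, Real.exp_injective.ne_iff] using hne
  have hdense := ContinuousMap.subalgebra_topologicalClosure_eq_top_of_separatesPoints _ hsep
  refine SetLike.coe_injective ?_
  exact (congrArg (fun M : Submodule ℝ C(X, ℝ) => closure (M : Set C(X, ℝ))) hspan).trans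
    (congrArg SetLike.coe hdense)

theorem topologicalClosure_span_ridge_eq_top {σ : C(ℝ, ℝ)}
    (hσ : ¬ ∃ q : Polynomial ℝ, ∀ x, σ x = q.eval x) {W : Submodule ℝ C(X, ℝ)}
    (hW : ∀ x y : X, x ≠ y → ∃ g ∈ W, g x ≠ g y) :
    (Submodule.span ℝ {χ | ∃ g ∈ W, ∃ θ, χ = σ.comp (g + .const X θ)}).topologicalClosure = ⊤ := by
  set V := (Submodule.span ℝ {χ | ∃ g ∈ W, ∃ θ, χ = σ.comp (g + .const X θ)}).topologicalClosure
  have hV : IsClosed (V : Set C(X, ℝ)) := Submodule.isClosed_topologicalClosure _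
  have hpow (g) (hg : g ∈ W) (k : ℕ) : g ^ k ∈ V := by
    rw [← one_mul (g ^ k)]
    refine mul_pow_mem_of_comp_affine_mem hV g (fun ⟨q, _, hq⟩ => hσ ⟨q, hq⟩) fun w θ => ?_
    rw [one_mul]
    exact Submodule.le_topologicalClosure _
      (Submodule.subset_span ⟨w • g, W.smul_mem w hg, θ, rfl⟩)
  have hexp (g) (hg : g ∈ W) : NormedSpace.exp g ∈ V := by
    rw [NormedSpace.exp_eq_tsum ℝ]
    exact tsum_mem hV fun k => V.smul_mem _ (hpow g hg k)
  rw [eq_top_iff, ← topologicalClosure_span_exp_eq_top hW]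
  exact Submodule.topologicalClosure_minimal _
    (Submodule.span_le.2 (Set.image_subset_iff.2 hexp)) hV

end ContinuousMap

theorem exists_sum_mul_ridge_near {X ι : Type*} [TopologicalSpace X] [CompactSpace X] [Fintype ι]
    {σ : ℝ → ℝ} (hσ : Continuous σ) (hσ' : ¬ ∃ q : Polynomial ℝ, ∀ x, σ x = q.eval x)
    {φ : ι → C(X, ℝ)} (hφ : Function.Injective fun x k => φ k x) (G : C(X, ℝ)) {ε : ℝ}
    (hε : 0 < ε) :
    ∃ (m : ℕ) (w : Fin m → ι → ℝ) (N θ : Fin m → ℝ),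
      ∀ x, |∑ c, N c * σ (∑ k, w c k * φ k x + θ c) - G x| < ε := by
  have hsep (x y : X) (hxy : x ≠ y) : ∃ g ∈ Submodule.span ℝ (Set.range φ), g x ≠ g y := by
    obtain ⟨k, hk⟩ := Function.ne_iff.1 (hφ.ne hxy)
    exact ⟨φ k, Submodule.subset_span ⟨k, rfl⟩, hk⟩
  have hG : G ∈ (Submodule.span ℝ _).topologicalClosure :=
    (topologicalClosure_span_ridge_eq_top (σ := ⟨σ, hσ⟩) hσ' hsep).symm ▸ Submodule.mem_top
  obtain ⟨_, hf, hfG⟩ := Metric.mem_closure_iff.1 hG ε hε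
  obtain ⟨m, N, χ, rfl⟩ := Submodule.mem_span_set'.1 hf
  choose g hg θ hχ using fun c => (χ c).2
  choose w hw using fun c => Submodule.mem_span_range_iff_exists_fun ℝ |>.1 (hg c)
  refine ⟨m, w, N, θ, fun x => ?_⟩
  have hx := (ContinuousMap.dist_lt_iff hε).1 (dist_comm G _ ▸ hfG) x
  simpa [Real.dist_eq, ContinuousMap.sum_apply, hχ, ← hw] using hx

theorem exists_sum_mul_ridge_near_on {Y ι : Type*} [TopologicalSpace Y] [Fintype ι] {s : Set Y}
    (hs : IsCompact s) {Φ : Y → ι → ℝ} (hΦ : ContinuousOn Φ s) (hΦs : Set.InjOn Φ s)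
    {σ : ℝ → ℝ} (hσ : Continuous σ) (hσ' : ¬ ∃ q : Polynomial ℝ, ∀ x, σ x = q.eval x)
    {G : Y → ℝ} (hG : ContinuousOn G s) {ε : ℝ} (hε : 0 < ε) :
    ∃ m, 0 < m ∧ ∃ (w : Fin m → ι → ℝ) (N θ : Fin m → ℝ),
      ∀ u ∈ s, |∑ c, N c * σ (∑ k, w c k * Φ u k + θ c) - G u| < ε := by
  have : CompactSpace s := isCompact_iff_compactSpace.1 hs
  obtain ⟨m, w, N, θ, happrox⟩ := exists_sum_mul_ridge_near hσ hσ'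
    (φ := fun k => ⟨fun u : s => Φ u k, (continuous_apply k).comp hΦ.domRestrict⟩)
    (Set.injOn_iff_injective.1 hΦs) ⟨_, hG.domRestrict⟩ hε
  -- A zero neuron makes the width positive.
  refine ⟨m + 1, m.succ_pos, Fin.cons 0 w, Fin.cons 0 N, Fin.cons 0 θ, fun u hu => ?_⟩
  simpa [Fin.sum_univ_succ] using happrox ⟨u, hu⟩

open Matrix

theorem exists_vecMul_vandermonde_eq {F : Type*} [Field F] {n : ℕ} {v : Fin n → F}
    (hv : Function.Injective v) (w : Fin n → F) : ∃ z, z ᵥ* vandermonde v = w := by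
  have hdet : IsUnit (vandermonde v).det := (det_vandermonde_ne_zero_iff.2 hv).isUnit
  exact ⟨w ᵥ* (vandermonde v)⁻¹, by rw [vecMul_vecMul, nonsing_inv_mul _ hdet, vecMul_one]⟩

namespace B2S6

variable {L h p n : ℕ}

/-- The output, `r` steps after a unit impulse, of the zero-order hold discretization with sampling
interval `δ` of the linear system with state matrix `A`, input vector `b` and output vector `c`. -/
noncomputable def impulseResponse (A : Matrix (Fin n) (Fin n) ℝ) (δ : ℝ) (c b : Fin n → ℝ)
    (r : ℕ) : ℝ :=
  c ⬝ᵥ (NormedSpace.exp (δ • A) ^ r *ᵥ ((A⁻¹ * (NormedSpace.exp (δ • A) - 1)) *ᵥ b))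

theorem impulseResponse_smul (A : Matrix (Fin n) (Fin n) ℝ) (δ : ℝ) (c b : Fin n → ℝ) (t : ℝ)
    (r : ℕ) : impulseResponse A δ c (t • b) r = t * impulseResponse A δ c b r := by
  simp only [impulseResponse, mulVec_smul, dotProduct_smul, smul_eq_mul]

theorem impulseResponse_diagonal {a : Fin n → ℝ} (ha : ∀ l, a l ≠ 0) (δ : ℝ) (c b : Fin n → ℝ)
    (r : ℕ) : impulseResponse (diagonal a) δ c b r =
      ∑ l, c l * (Real.exp (δ * a l) ^ r * ((a l)⁻¹ * (Real.exp (δ * a l) - 1) * b l)) := by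
  have hexp : NormedSpace.exp (δ • diagonal a) = diagonal fun l => Real.exp (δ * a l) := by
    simp only [← diagonal_smul, exp_diagonal, Pi.exp_def, Pi.smul_apply, smul_eq_mul,
      Real.exp_eq_exp_ℝ]
  have hinv : (diagonal a)⁻¹ = diagonal fun l => (a l)⁻¹ := by
    refine inv_eq_right_inv ?_
    simp only [diagonal_mul_diagonal, mul_inv_cancel₀ (ha _), diagonal_one]
  simp only [impulseResponse, hexp, hinv, ← diagonal_one, diagonal_sub, diagonal_pow,
    diagonal_mul_diagonal, mulVec_diagonal, dotProduct, Pi.pow_apply]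

theorem exists_impulseResponse_diagonal_eq {a : Fin n → ℝ} (hainj : Function.Injective a)
    (ha : ∀ l, a l ≠ 0) {δ : ℝ} (hδ : δ ≠ 0) (w : Fin n → ℝ) :
    ∃ b, ∀ r : Fin n, impulseResponse (diagonal a) δ 1 b r = w r := by
  have hinj : Function.Injective fun l => Real.exp (δ * a l) :=
    Real.exp_injective.comp ((mul_right_injective₀ hδ).comp hainj)
  have hgain (l : Fin n) : (a l)⁻¹ * (Real.exp (δ * a l) - 1) ≠ 0 :=
    mul_ne_zero (inv_ne_zero (ha l))
      (sub_ne_zero.2 (Real.exp_eq_one_iff _ |>.not.2 (mul_ne_zero hδ (ha l))))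
  obtain ⟨z, rfl⟩ := exists_vecMul_vandermonde_eq hinj w
  refine ⟨fun l => z l / ((a l)⁻¹ * (Real.exp (δ * a l) - 1)), fun r => ?_⟩
  simp only [impulseResponse_diagonal ha, mul_div_cancel₀ _ (hgain _), Pi.one_apply, one_mul,
    vecMul, dotProduct, vandermonde_apply, mul_comm]

theorem isCompact_inputs (hL : 1 ≤ L) : IsCompact (inputs hL) := by
  have hinter : inputs hL =
      (Set.univ.pi fun _ => Set.Icc (0 : ℝ) 1) ∩ {u | u (lastPos hL) = 1} := by
    ext u
    simp only [inputs, Set.mem_ofPred_eq, Set.mem_inter_iff, Set.mem_univ_pi]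
  rw [hinter]
  exact (isCompact_univ_pi fun _ => isCompact_Icc).inter_right
    (isClosed_eq (continuous_apply _) continuous_const)

theorem injOn_sq_inputs (hL : 1 ≤ L) : Set.InjOn (fun u k => u k ^ 2) (inputs hL) :=
  fun _ hu _ hv huv =>
    funext fun k => (sq_eq_sq₀ (hu.1 k).1 (hv.1 k).1).1 (congrFun huv k)

theorem stack_apply (y : Fin h → Fin p → ℝ) (j : Fin h) (i : Fin p) :
    stack y (finProdFinEquiv (j, i)) = y j i := by
  simp only [stack, Equiv.symm_apply_apply]

theorem block_smul_one (x : ℝ) (j : Fin h) : block (x • (1 : Fin (h * p) → ℝ)) j = fun _ => x :=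
  funext fun _ => mul_one x

namespace Params

theorem state_eq_sum (P : Params h p n) (δ : Fin h → Fin p → ℝ) (U : Fin L → Fin (h * p) → ℝ)
    (j : Fin h) (i : Fin p) (k : ℕ) (hk : k ≤ L) :
    P.state (fun _ => δ) U j i k hk = ∑ s : Fin k, block (U (s.castLE hk)) j i •
      (P.Abar (δ j i) ^ (s.rev : ℕ) *ᵥ P.Bbar (δ j i) j i (block (U (s.castLE hk)) j)) := by
  induction k with
  | zero => rfl
  | succ k ih =>
    rw [state, ih, mulVec_sum, Fin.sum_univ_castSucc]
    simp only [mulVec_smul, mulVec_mulVec, ← pow_succ', Fin.rev_castSucc, Fin.val_succ,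
      Fin.rev_last, Fin.val_zero, pow_zero, one_mulVec]
    rfl

theorem unit_lastPos_apply (P : Params h p n) (hL : 1 ≤ L) (δ : Fin h → Fin p → ℝ)
    (U : Fin L → Fin (h * p) → ℝ) (j : Fin h) (i : Fin p) :
    P.unit (fun _ => δ) U (lastPos hL) (finProdFinEquiv (j, i)) =
      ∑ k, block (U k) j i * impulseResponse P.A (δ j i) (P.Cbar j (block (U (lastPos hL)) j))
        (P.Bweight j *ᵥ block (U k) j + P.Bbias j i) k.rev := by
  obtain ⟨L, rfl⟩ := Nat.exists_eq_add_of_le' hL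
  rw [unit, stack_apply, state_eq_sum, dotProduct_sum]
  simp only [dotProduct_smul, smul_eq_mul]
  rfl

theorem singleLayer_unit_one (P : Params h p n) (hL : 1 ≤ L) (δ : Fin h → Fin p → ℝ)
    (σ : ℝ → ℝ) (N θ : Fin h → Fin p → ℝ) (u : Fin L → ℝ) :
    singleLayer hL σ (P.unit fun _ => δ) 1 (stack N) (stack θ) u =
      ∑ j, ∑ i, N j i * σ (∑ k, u k * impulseResponse P.A (δ j i)
        (P.Cbar j fun _ => u (lastPos hL)) (P.Bweight j *ᵥ (fun _ => u k) + P.Bbias j i) k.rev +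
          θ j i) := by
  rw [singleLayer, ← finProdFinEquiv.sum_comp, Fintype.sum_prod_type]
  simp only [stack_apply, unit_lastPos_apply, block_smul_one]

end Params

variable {a : Fin L → ℝ} {Δ : ℝ} {σ : ℝ → ℝ} {G : (Fin L → ℝ) → ℝ} {ε : ℝ}

theorem exists_unbiased_unit_near (hL : 1 ≤ L) (hainj : Function.Injective a) (ha : ∀ l, a l ≠ 0)
    (hΔ : Δ ≠ 0) (hσ : Continuous σ) (hσ' : ¬ ∃ q : Polynomial ℝ, ∀ x, σ x = q.eval x)
    (hG : ContinuousOn G (inputs hL)) (hε : 0 < ε) :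
    ∃ h, 0 < h ∧ ∃ (M N θ : Fin (h * 1) → ℝ) (P : Params h 1 L),
      P.A = diagonal a ∧ (∀ j i, P.Bbias j i = 0) ∧
      ∀ u ∈ inputs hL, |singleLayer hL σ (P.unit fun _ _ _ => Δ) M N θ u - G u| < ε := by
  obtain ⟨h, hh, w, N, θ, happrox⟩ := exists_sum_mul_ridge_near_on (isCompact_inputs hL)
    (Φ := fun u k => u k ^ 2) (by fun_prop) (injOn_sq_inputs hL) hσ hσ' hG hε
  choose b hb using fun j =>
    exists_impulseResponse_diagonal_eq hainj ha hΔ fun k => w j k.rev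
  let P : Params h 1 L :=
    { A := diagonal a
      Bweight := fun j => replicateCol (Fin 1) (b j)
      Bbias := 0
      C := fun _ => replicateRow (Fin 1) 1 }
  refine ⟨h, hh, 1, stack fun j _ => N j, stack fun j _ => θ j, P, rfl, fun _ _ => rfl,
    fun u hu => ?_⟩
  have hC (j : Fin h) : P.Cbar j (fun _ => u (lastPos hL)) = 1 := by
    funext l
    simp [P, Params.Cbar, vecMul, dotProduct, hu.2]
  have hB (j : Fin h) (k : Fin L) : P.Bweight j *ᵥ (fun _ => u k) + P.Bbias j 0 = u k • b j := by
    funext l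
    simp [P, mulVec, dotProduct, mul_comm]
  have hresponse (j : Fin h) (k : Fin L) :
      u k * impulseResponse P.A Δ 1 (u k • b j) k.rev = w j k * u k ^ 2 := by
    rw [impulseResponse_smul, hb, Fin.rev_rev]
    ring
  simpa only [Params.singleLayer_unit_one, Fin.sum_univ_one, hC, hB, hresponse] using happrox u hu

theorem exists_one_block_unit_near (hL : 1 ≤ L) (hainj : Function.Injective a)
    (ha : ∀ l, a l ≠ 0) (hΔ : Δ ≠ 0) (hσ : Continuous σ)
    (hσ' : ¬ ∃ q : Polynomial ℝ, ∀ x, σ x = q.eval x)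
    (hG : ContinuousOn G (inputs hL)) (hε : 0 < ε) :
    ∃ d, 0 < d ∧ ∃ (M N θ : Fin (1 * d) → ℝ) (P : Params 1 d L), P.A = diagonal a ∧
      ∀ u ∈ inputs hL, |singleLayer hL σ (P.unit fun _ _ _ => Δ) M N θ u - G u| < ε := by
  obtain ⟨d, hd, w, N, θ, happrox⟩ := exists_sum_mul_ridge_near_on (isCompact_inputs hL)
    (Φ := fun u => u) continuousOn_id (Set.injOn_id _) hσ hσ' hG hε
  choose b hb using fun i =>
    exists_impulseResponse_diagonal_eq hainj ha hΔ fun k => w i k.rev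
  let P : Params 1 d L :=
    { A := diagonal a
      Bweight := 0
      Bbias := fun _ => b
      C := fun _ => vecMulVec (Pi.single ⟨0, hd⟩ 1) 1 }
  refine ⟨d, hd, 1, stack fun _ => N, stack fun _ => θ, P, rfl, fun u hu => ?_⟩
  have hC : P.Cbar 0 (fun _ => u (lastPos hL)) = 1 := by
    simp only [P, Params.Cbar, vecMul_vecMulVec, dotProduct_single, hu.2, mul_one, one_smul]
  have hB (i : Fin d) (k : Fin L) : P.Bweight 0 *ᵥ (fun _ => u k) + P.Bbias 0 i = b i := by
    simp [P]
  have hresponse (i : Fin d) (k : Fin L) :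
      u k * impulseResponse P.A Δ 1 (b i) k.rev = w i k * u k := by
    rw [hb, Fin.rev_rev, mul_comm]
  simpa only [Params.singleLayer_unit_one, Fin.sum_univ_one, hC, hB, hresponse] using happrox u hu

end B2S6

theorem mainTheorem4_general (Δ : ℝ) (hΔ : Δ ≠ 0) (L : ℕ) (hL : 1 ≤ L)
    (σ : ℝ → ℝ) (hσ : Continuous σ)
    (hσ' : ¬ ∃ q : Polynomial ℝ, ∀ x, σ x = q.eval x)
    (G : (Fin L → ℝ) → ℝ) (hG : ContinuousOn G (B2S6.inputs hL)) (ε : ℝ) (hε : 0 < ε) :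
    (∃ h p n : ℕ, 1 ≤ h ∧ 1 ≤ p ∧ 1 ≤ n ∧
      ∃ (M N θ : Fin (h * p) → ℝ) (P : B2S6.Params h p n),
        P.A.IsDiag ∧ IsUnit P.A ∧ (∀ j i, P.Bbias j i = 0) ∧
        ∀ u ∈ B2S6.inputs hL,
          |B2S6.singleLayer hL σ (P.unit fun _ _ _ => Δ) M N θ u - G u| ≤ ε) ∧
    (∃ d n : ℕ, 1 ≤ d ∧ 1 ≤ n ∧
      ∃ (M N θ : Fin (1 * d) → ℝ) (P : B2S6.Params 1 d n),
        P.A.IsDiag ∧ IsUnit P.A ∧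
        ∀ u ∈ B2S6.inputs hL,
          |B2S6.singleLayer hL σ (P.unit fun _ _ _ => Δ) M N θ u - G u| ≤ ε) := by
  let a : Fin L → ℝ := fun l => l + 1
  have hainj : Function.Injective a := fun _ _ h => by simpa [a, Fin.ext_iff] using h
  have ha (l : Fin L) : a l ≠ 0 := Nat.cast_add_one_ne_zero l
  have hunit : IsUnit (diagonal a) := by
    simpa only [isUnit_diagonal, Pi.isUnit_iff, isUnit_iff_ne_zero] using ha
  constructor
  · obtain ⟨h, hh, M, N, θ, P, hA, hbias, happrox⟩ :=
      B2S6.exists_unbiased_unit_near hL hainj ha hΔ hσ hσ' hG hε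
    exact ⟨h, 1, L, hh, le_rfl, hL, M, N, θ, P, hA ▸ isDiag_diagonal a, hA ▸ hunit, hbias,
      fun u hu => (happrox u hu).le⟩
  · obtain ⟨d, hd, M, N, θ, P, hA, happrox⟩ :=
      B2S6.exists_one_block_unit_near hL hainj ha hΔ hσ hσ' hG hε
    exact ⟨d, L, hd, hL, M, N, θ, P, hA ▸ isDiag_diagonal a, hA ▸ hunit,
      fun u hu => (happrox u hu).le⟩

theorem mainTheorem4 (Δ : ℝ) (hΔ : 0 < Δ) (L : ℕ) (hL : 1 ≤ L)
    (σ : ℝ → ℝ) (hσ : ∃ K : NNReal, LipschitzWith K σ)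
    (hσ' : ¬ ∃ q : Polynomial ℝ, ∀ x, σ x = q.eval x)
    (G : (Fin L → ℝ) → ℝ) (hG : ContinuousOn G (B2S6.inputs hL)) (ε : ℝ) (hε : 0 < ε) :
    (∃ h p n : ℕ, 1 ≤ h ∧ 1 ≤ p ∧ 1 ≤ n ∧
      ∃ (M N θ : Fin (h * p) → ℝ) (P : B2S6.Params h p n),
        P.A.IsDiag ∧ IsUnit P.A ∧ (∀ j i, P.Bbias j i = 0) ∧
        ∀ u ∈ B2S6.inputs hL,
          |B2S6.singleLayer hL σ (P.unit fun _ _ _ => Δ) M N θ u - G u| ≤ ε) ∧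
    (∃ d n : ℕ, 1 ≤ d ∧ 1 ≤ n ∧
      ∃ (M N θ : Fin (1 * d) → ℝ) (P : B2S6.Params 1 d n),
        P.A.IsDiag ∧ IsUnit P.A ∧
        ∀ u ∈ B2S6.inputs hL,
          |B2S6.singleLayer hL σ (P.unit fun _ _ _ => Δ) M N θ u - G u| ≤ ε) := by
  obtain ⟨_, hK⟩ := hσ
  exact mainTheorem4_general Δ hΔ.ne' L hL σ hK.continuous hσ' G hG ε hε
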